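/- Let $G$ be a finitely presented group and let $\eta\colon\mathcal X\to G$ be any finite generating system (a map from a finite set whose image generates $G$). A character of $G$ is a homomorphism $\chi\colon G\to(\mathbb R,+)$; the character sphere is $S(G)=\{[\chi]\mid \chi\in\operatorname{Hom}(G,\mathbb R)\setminus\{0\}\}$, where $[\chi]$ is the ray $\{r\chi\mid r>0\}$, and $-[\chi]=[-\chi]$. Let $\Sigma^1(G)\subseteq S(G)$ be the set of those $[\chi]$ for which the full subgraph of the Cayley graph $\Gamma(G,\mathcal X)$ (with edges joining $g$ and $g\cdot\eta(x)$) on the vertex set $\{g\in G\mid\chi(g)\ge 0\}$ is connected. Then the following hold. (1) Let $\chi$ be a non-zero character of $G$ such that both $[\chi]$ and $-[\chi]$ lie outside $\Sigma^1(G)$, and let $N=\ker\chi$. Then $N$ has subgroups $S_-$, $S_+$ and $S_0\subseteq S_-\cap S_+$ such that the inclusions induce an isomorphism of the free product with amalgamation $S_-\star_{S_0}S_+$ onto $N$, the subgroup $S_0$ has infinite index both in $S_-$ and in $S_+$, and neither $S_-$ nor $S_+$ is finitely generated. Moreover, $N$ contains a non-abelian free subgroup. (2) If $G$ contains no non-abelian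 free subgroup, then $\Sigma^1(G)\cup-\Sigma^1(G)=S(G)$, where $-\Sigma^1(G)=\{-p\mid p\in\Sigma^1(G)\}$. In particular, $\Sigma^1(G)$ is non-empty unless the abelianization $G/G'$ is finite. -/

import Mathlib

universe u v

namespace SigmaInvariant

/-- Characters of `G`: homomorphisms from `G` to the additive group of the reals, with their
pointwise structure of a real vector space. -/
abbrev Character (G : Type u) [Group G] : Type u := Additive G →+ ℝ

/-- The kernel of a character, as a subgroup of `G`. -/
abbrev characterKer {G : Type u} [Group G] (χ : Character G) : Subgroup G :=
  (AddMonoidHom.toMultiplicativeRight χ).ker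

/-- The character sphere `S(G)`: the rays spanned by the non-zero characters, two of which are
equivalent when they are positive multiples of each other. -/
abbrev CharacterSphere (G : Type u) [Group G] : Type u := Module.Ray ℝ (Character G)

/-- The point `[χ]` of the character sphere. -/
noncomputable abbrev spherePoint {G : Type u} [Group G] (χ : Character G) (hχ : χ ≠ 0) :
    CharacterSphere G :=
  rayOfNeZero ℝ χ hχ

/-- `η` is a finite generating system of `G`. -/
structure IsFiniteGeneratingSystem {G : Type u} [Group G] {X : Type v} (η : X → G) : Prop where
  finite : Finite X
  generates : Subgroup.closure (Set.range η) = ⊤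

/-- The full subgraph `Γ_χ` of the Cayley graph of `G` with respect to `η` (with edges joining
`g` and `g * η x`) on the set of vertices `g` with `0 ≤ χ g`. -/
def halfCayleyGraph {G : Type u} [Group G] {X : Type v} (η : X → G) (χ : Character G) :
    SimpleGraph {g : G | 0 ≤ χ (Additive.ofMul g)} :=
  (SimpleGraph.mulCayley (Set.range η)).induce {g : G | 0 ≤ χ (Additive.ofMul g)}

/-- The invariant `Σ¹`, computed with the generating system `η`. -/
def sigmaOne {G : Type u} [Group G] {X : Type v} (η : X → G) : Set (CharacterSphere G) :=
  {p | ∃ (χ : Character G) (hχ : χ ≠ 0), spherePoint χ hχ = p ∧ (halfCayleyGraph η χ).Connected}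

/-- Characters in the same ray have the same half Cayley graph, so
membership in `sigmaOne η` may be tested on any representative. -/
theorem spherePoint_mem_sigmaOne {G : Type u} [Group G] {X : Type v} (η : X → G)
    (χ : Character G) (hχ : χ ≠ 0) :
    spherePoint χ hχ ∈ sigmaOne η ↔ (halfCayleyGraph η χ).Connected := by
  constructor
  · rintro ⟨ψ, hψ, he, hc⟩
    obtain ⟨r, hr, rfl⟩ := ((ray_eq_iff hψ hχ).1 he).exists_pos_left hψ hχ
    have hset : {g : G | 0 ≤ (r • ψ) (Additive.ofMul g)} = {g : G | 0 ≤ ψ (Additive.ofMul g)} := by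
      ext g
      simp [hr]
    unfold halfCayleyGraph at hc ⊢
    rw [hset]
    exact hc
  · intro h
    exact ⟨χ, hχ, rfl, h⟩

/-- The canonical homomorphism to `N` from the free product of a family of subgroups `A i` of `N`
amalgamated along their common subgroup `H`, induced by the inclusions. -/
def amalgamMap {ι : Type v} {N : Type u} [Group N] (H : Subgroup N) (A : ι → Subgroup N)
    (h : ∀ i, H ≤ A i) :
    Monoid.PushoutI (fun i => Subgroup.inclusion (h i)) →* N :=
  Monoid.PushoutI.lift (fun i => (A i).subtype) H.subtype (fun _ => rfl)

theorem amalgamMap_of {ι : Type v} {N : Type u} [Group N] (H : Subgroup N) (A : ι → Subgroup N)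
    (h : ∀ i, H ≤ A i) (i : ι) (x : A i) :
    amalgamMap H A h (Monoid.PushoutI.of (φ := fun i => Subgroup.inclusion (h i)) i x) = (x : N) :=
  Monoid.PushoutI.lift_of (φ := fun i => Subgroup.inclusion (h i)) _ _ _ x

theorem amalgamMap_base {ι : Type v} {N : Type u} [Group N] (H : Subgroup N) (A : ι → Subgroup N)
    (h : ∀ i, H ≤ A i) (x : H) :
    amalgamMap H A h (Monoid.PushoutI.base (fun i => Subgroup.inclusion (h i)) x) = (x : N) :=
  Monoid.PushoutI.lift_base (φ := fun i => Subgroup.inclusion (h i)) _ _ _ x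

/-- `N = Sm ⋆_{S0} Sp`: the subgroup `S0` is contained in `Sm` and in `Sp`, and the inclusions
induce an isomorphism from the free product with amalgamation onto `N`. -/
def IsFreeProductWithAmalgamation {N : Type u} [Group N] (S0 Sm Sp : Subgroup N) : Prop :=
  ∃ h : ∀ i : Bool, S0 ≤ cond i Sp Sm,
    Function.Bijective (amalgamMap S0 (fun i : Bool => cond i Sp Sm) h)

/-- `N` contains a non-abelian free subgroup. -/
def HasNonabelianFreeSubgroup (N : Type u) [Group N] : Prop :=
  ∃ F : Subgroup N, IsFreeGroup F ∧ ∃ a b : F, a * b ≠ b * a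

end SigmaInvariant

/-!
Let `χ` be a non-zero character and `N` its kernel. Take a finite presentation of `G` and `c` so
large that no generator changes `χ` by more than `c` and every relator is joined to `1`, in the
Cayley graph of the free group, by a path of heights in `[-c, c]`. The half spaces `{-c ≤ χ}` and
`{χ ≤ c}` cover the Cayley graph of `G`, meet in a strip, and contain every translate of every
relator in one of the two. Hence `N` is the amalgam of the subgroups of elements that can be reached
from `1` inside the half spaces, over the subgroup of those that can be reached inside the strip:
label each edge by its Schreier generator for the transversal of `N`, lifted to the amalgam; the
product of the labels around each relator lies in one factor and is trivial in `N`, so it is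
trivial, and the product of the labels along a path depends only on the ends of the path. Restricted
to `N`, this inverts the canonical map from the amalgam.

The subgroups belonging to one side increase with `c` and exhaust `N`. If neither `χ` nor `-χ`
represents a point of `Σ¹`, none of them contains a subgroup belonging to the other side:
translation by an element of large height moves a half space into any other half space of the same
side, so otherwise one side would contain all of `N` and its half space would be connected. This
makes both indices infinite and both factors infinitely generated. Ping-pong on alternating products
of elements of the two factors produces the free subgroup.

For the last assertion, an infinite finitely generated abelian group has an element of infinite
order, and divisibility of `ℝ` yields a character that does not vanish on it.
-/

namespace SigmaInvariant

section HeightConnected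

variable {H : Type*} [Group H] {Y : Type*}

theorem eq_of_mul_generator_eq {y : Y → H} (hy : Subgroup.closure (Set.range y) = ⊤) {α : Sort*}
    {F : H → α} (hF : ∀ g i, F (g * y i) = F g) (g h : H) : F g = F h := by
  have key : ∀ k g, F (g * k) = F g := fun k => by
    have hk : k ∈ Subgroup.closure (Set.range y) := hy ▸ Subgroup.mem_top k
    induction hk using Subgroup.closure_induction with
    | mem x hx => obtain ⟨i, rfl⟩ := hx; exact fun g => hF g i
    | one => simp
    | mul a b _ _ iha ihb => intro g; rw [← mul_assoc, ihb, iha]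
    | inv a _ iha => intro g; rw [← iha, inv_mul_cancel_right]
  rw [← key (h⁻¹ * g) h, mul_inv_cancel_left]

theorem closure_range_comp {K : Type*} [Group K] {f : K →* H} (hf : Function.Surjective f)
    {z : Y → K} (hz : Subgroup.closure (Set.range z) = ⊤) :
    Subgroup.closure (Set.range (f ∘ z)) = ⊤ := by
  rw [Set.range_comp, ← MonoidHom.map_closure, hz, Subgroup.map_top_of_surjective f hf]

/-- `g` and `h` are the ends of an edge path in the Cayley graph of `H` with respect to `y` all of
whose vertices have `χ`-value in `I`. The constant path at `g` is allowed even if `χ g ∉ I`, which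
makes this an equivalence relation on all of `H`. -/
def HeightConnected (y : Y → H) (χ : Character H) (I : Set ℝ) : H → H → Prop :=
  Relation.EqvGen fun g h => χ (.ofMul g) ∈ I ∧ χ (.ofMul h) ∈ I ∧ ∃ i, h = g * y i

/-- The relation `HeightConnected y χ I`, bundled as a setoid. -/
def heightSetoid (y : Y → H) (χ : Character H) (I : Set ℝ) : Setoid H where
  r := HeightConnected y χ I
  iseqv := Relation.EqvGen.is_equivalence _

variable {y : Y → H} {χ : Character H} {I J : Set ℝ} {g h k : H}

namespace HeightConnected

theorem refl (g : H) : HeightConnected y χ I g g := Relation.EqvGen.refl g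

theorem symm (hgh : HeightConnected y χ I g h) : HeightConnected y χ I h g :=
  Relation.EqvGen.symm _ _ hgh

theorem trans (hgh : HeightConnected y χ I g h) (hhk : HeightConnected y χ I h k) :
    HeightConnected y χ I g k :=
  Relation.EqvGen.trans _ _ _ hgh hhk

theorem edge {i : Y} (hg : χ (.ofMul g) ∈ I) (hgi : χ (.ofMul (g * y i)) ∈ I) :
    HeightConnected y χ I g (g * y i) :=
  Relation.EqvGen.rel _ _ ⟨hg, hgi, i, rfl⟩

theorem mul_of_mem {x : H} (hx : x ∈ Set.range y ∪ (Set.range y)⁻¹) (hg : χ (.ofMul g) ∈ I)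
    (hgx : χ (.ofMul (g * x)) ∈ I) : HeightConnected y χ I g (g * x) := by
  rcases hx with ⟨i, rfl⟩ | ⟨i, hi⟩
  · exact edge hg hgx
  · have hg' : g * x * y i = g := by rw [hi, mul_inv_cancel_right]
    have := edge (y := y) (i := i) hgx (by rwa [hg'])
    rw [hg'] at this
    exact this.symm

theorem setoid_rel (s : Setoid H)
    (hs : ∀ g i, χ (.ofMul g) ∈ I → χ (.ofMul (g * y i)) ∈ I → s g (g * y i))
    (hgh : HeightConnected y χ I g h) : s g h := by
  refine Setoid.eqvGen_le (s := s) ?_ hgh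
  rintro g _ ⟨hg, hgi, i, rfl⟩
  exact hs g i hg hgi

theorem translate (k : H) (hIJ : Set.MapsTo (χ (.ofMul k) + ·) I J)
    (hgh : HeightConnected y χ I g h) : HeightConnected y χ J (k * g) (k * h) := by
  refine hgh.setoid_rel ((heightSetoid y χ J).comap (k * ·)) fun a i ha hai => ?_
  change HeightConnected y χ J (k * a) (k * (a * y i))
  rw [← mul_assoc]
  refine edge ?_ ?_
  · simpa only [ofMul_mul, map_add] using hIJ ha
  · simpa only [mul_assoc, ofMul_mul, map_add] using hIJ hai

theorem translate_ker (hk : χ (.ofMul k) = 0) (hgh : HeightConnected y χ I g h) :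
    HeightConnected y χ I (k * g) (k * h) :=
  hgh.translate k fun t ht => by simpa only [hk, zero_add] using ht

theorem mono (hIJ : I ⊆ J) (hgh : HeightConnected y χ I g h) : HeightConnected y χ J g h :=
  hgh.setoid_rel (heightSetoid y χ J) fun _ _ ha hai => edge (hIJ ha) (hIJ hai)

end HeightConnected

open HeightConnected

theorem heightConnected_neg : HeightConnected y (-χ) I g h ↔ HeightConnected y χ (-I) g h :=
  Iff.rfl

theorem exists_heightConnected_Icc (hy : Subgroup.closure (Set.range y) = ⊤) (χ : Character H)
    (g h : H) : ∃ M, HeightConnected y χ (Set.Icc (-M) M) g h := by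
  let s : Setoid H :=
    { r := fun g h => ∃ M, HeightConnected y χ (Set.Icc (-M) M) g h
      iseqv :=
        ⟨fun g => ⟨0, refl g⟩, fun ⟨M, hM⟩ => ⟨M, hM.symm⟩, fun ⟨M, hM⟩ ⟨M', hM'⟩ =>
          ⟨max M M',
            (hM.mono (Set.Icc_subset_Icc (neg_le_neg (le_max_left _ _)) (le_max_left _ _))).trans
            (hM'.mono (Set.Icc_subset_Icc (neg_le_neg (le_max_right _ _)) (le_max_right _ _)))⟩⟩ }
  refine Quotient.exact (s := s) (eq_of_mul_generator_eq hy (F := Quotient.mk s) ?_ g h)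
  refine fun g i => Quotient.sound ⟨max |χ (.ofMul g)| |χ (.ofMul (g * y i))|, symm (edge ?_ ?_)⟩
  · exact abs_le.1 (le_max_left _ _)
  · exact abs_le.1 (le_max_right _ _)

theorem exists_heightConnected_of_generators (hy : Subgroup.closure (Set.range y) = ⊤)
    (χ : Character H) {Z : Type*} [Finite Z] (z : Z → H) :
    ∃ M, ∀ I J : Set ℝ, (∀ t ∈ I, Set.Icc (t - M) (t + M) ⊆ J) →
      ∀ g h, HeightConnected z χ I g h → HeightConnected y χ J g h := by
  choose M hM using fun i => exists_heightConnected_Icc hy χ 1 (z i)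
  obtain ⟨B, hB⟩ := (Set.finite_range M).bddAbove
  refine ⟨B, fun I J hIJ g h hgh => ?_⟩
  refine hgh.setoid_rel (heightSetoid y χ J) fun a i ha _ => ?_
  have hMB : M i ≤ B := hB ⟨i, rfl⟩
  have := (hM i).translate (J := J) a fun t ht => hIJ _ ha
    ⟨by linarith [ht.1], by linarith [ht.2]⟩
  rwa [mul_one] at this

theorem exists_mem_add_mem_of_nonneg {I : Set ℝ} (hI : I.OrdConnected) {c : ℝ}
    (hcI : Set.Icc (-c) c ⊆ I) {s : Multiset ℝ} (hs : s ≠ 0) (hsc : ∀ x ∈ s, |x| ≤ c) {t : ℝ}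
    (ht : t ∈ I) (hts : t + s.sum ∈ I) (ht0 : 0 ≤ t) : ∃ x ∈ s, t + x ∈ I := by
  by_cases hneg : ∃ x ∈ s, x < 0
  · obtain ⟨x, hx, hx0⟩ := hneg
    have hxc := abs_le.1 (hsc x hx)
    have hc : -c ∈ I := hcI ⟨le_rfl, by linarith⟩
    exact ⟨x, hx, hI.out hc ht ⟨by linarith, by linarith⟩⟩
  · push Not at hneg
    obtain ⟨x, hx⟩ := Multiset.exists_mem_of_ne_zero hs
    have hle := Multiset.single_le_sum hneg x hx
    exact ⟨x, hx, hI.out ht hts ⟨by linarith [hneg x hx], by linarith⟩⟩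

/-- Steps of length at most `c` whose sum leads from a point of `I` to another one can be taken in
an order that never leaves `I`: away from `[-c, c]`, the next step goes towards `0`, unless all the
remaining steps go the other way. -/
theorem exists_mem_add_mem {I : Set ℝ} (hI : I.OrdConnected) {c : ℝ}
    (hcI : Set.Icc (-c) c ⊆ I) {s : Multiset ℝ} (hs : s ≠ 0) (hsc : ∀ x ∈ s, |x| ≤ c) {t : ℝ}
    (ht : t ∈ I) (hts : t + s.sum ∈ I) : ∃ x ∈ s, t + x ∈ I := by
  rcases le_total 0 t with ht0 | ht0
  · exact exists_mem_add_mem_of_nonneg hI hcI hs hsc ht hts ht0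
  · obtain ⟨x, hx, hxI⟩ := exists_mem_add_mem_of_nonneg (I := -I) (s := s.map Neg.neg) (t := -t)
      (hI.preimage_anti fun _ _ => neg_le_neg)
      (fun u hu => hcI ⟨neg_le_neg hu.2, neg_le.1 hu.1⟩)
      (by simpa only [ne_eq, Multiset.map_eq_zero] using hs)
      (by simpa only [Multiset.mem_map, forall_exists_index, and_imp, forall_apply_eq_imp_iff₂,
        abs_neg] using hsc)
      (by simpa only [Set.mem_neg, neg_neg] using ht)
      (by simpa only [Multiset.sum_map_neg', ← neg_add, Set.mem_neg, neg_neg] using hts)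
      (neg_nonneg.2 ht0)
    obtain ⟨x, hxs, rfl⟩ := Multiset.mem_map.1 hx
    exact ⟨x, hxs, by simpa only [← neg_add, Set.mem_neg, neg_neg] using hxI⟩

theorem abs_apply_le_of_mem_generators {c : ℝ} (hc : ∀ i, |χ (.ofMul (y i))| ≤ c) {x : H}
    (hx : x ∈ Set.range y ∪ (Set.range y)⁻¹) : |χ (.ofMul x)| ≤ c := by
  rcases hx with ⟨i, rfl⟩ | ⟨i, hi⟩
  · exact hc i
  · simpa only [hi, ofMul_inv, map_neg, abs_neg] using hc i

theorem exists_heightConnected_add_sum {c : ℝ} (hc : ∀ i, |χ (.ofMul (y i))| ≤ c)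
    (hI : I.OrdConnected) (hcI : Set.Icc (-c) c ⊆ I) (s : Multiset H)
    (hs : ∀ x ∈ s, x ∈ Set.range y ∪ (Set.range y)⁻¹) (g : H) (hg : χ (.ofMul g) ∈ I)
    (hgs : χ (.ofMul g) + (s.map fun x => χ (.ofMul x)).sum ∈ I) :
    ∃ h, χ (.ofMul h) = χ (.ofMul g) + (s.map fun x => χ (.ofMul x)).sum ∧
      HeightConnected y χ I g h := by
  classical
  induction s using Multiset.strongInductionOn generalizing g with
  | ih s ih =>
    rcases eq_or_ne s 0 with rfl | hs0
    · exact ⟨g, by simp, refl g⟩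
    obtain ⟨t, ht, htI⟩ := exists_mem_add_mem hI hcI (s := s.map fun x => χ (.ofMul x))
      (by simpa only [ne_eq, Multiset.map_eq_zero] using hs0)
      (by simpa only [Multiset.mem_map, forall_exists_index, and_imp, forall_apply_eq_imp_iff₂]
        using fun x hx => abs_apply_le_of_mem_generators hc (hs x hx)) hg hgs
    obtain ⟨x, hx, rfl⟩ := Multiset.mem_map.1 ht
    have hsum : χ (.ofMul (g * x)) + ((s.erase x).map fun x => χ (.ofMul x)).sum =
        χ (.ofMul g) + (s.map fun x => χ (.ofMul x)).sum := by
      conv_rhs => rw [← Multiset.cons_erase hx, Multiset.map_cons, Multiset.sum_cons]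
      rw [ofMul_mul, map_add, add_assoc]
    rw [← map_add, ← ofMul_mul] at htI
    obtain ⟨h, hh, hgh⟩ := ih _ (Multiset.erase_lt.2 hx)
      (fun z hz => hs z (Multiset.mem_of_mem_erase hz)) (g * x) htI (hsum ▸ hgs)
    exact ⟨h, hh.trans hsum, (mul_of_mem (hs x hx) hg htI).trans hgh⟩

theorem exists_heightConnected_one (hy : Subgroup.closure (Set.range y) = ⊤) {c : ℝ} (hc0 : 0 ≤ c)
    (hc : ∀ i, |χ (.ofMul (y i))| ≤ c) (g : H) :
    ∃ h, χ (.ofMul h) = χ (.ofMul g) ∧ ∀ I : Set ℝ, I.OrdConnected → Set.Icc (-c) c ⊆ I →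
      χ (.ofMul g) ∈ I → HeightConnected y χ I 1 h := by
  set hull : Set ℝ := Set.Icc (min (-c) (χ (.ofMul g))) (max c (χ (.ofMul g))) with hhull
  have hg : g ∈ (Subgroup.closure (Set.range y)).toSubmonoid := hy ▸ Subgroup.mem_top g
  rw [Subgroup.closure_toSubmonoid] at hg
  obtain ⟨L, hL, rfl⟩ := Submonoid.exists_list_of_mem_closure hg
  have hsum : χ (.ofMul (1 : H)) + ((L : Multiset H).map fun x => χ (.ofMul x)).sum =
      χ (.ofMul L.prod) := by
    rw [ofMul_one, map_zero, zero_add, Multiset.map_coe, Multiset.sum_coe, ofMul_list_prod,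
      map_list_sum, List.map_map]
    rfl
  obtain ⟨h, hh, hconn⟩ := exists_heightConnected_add_sum (y := y) (χ := χ) hc
    (I := hull) Set.ordConnected_Icc (Set.Icc_subset_Icc (min_le_left _ _) (le_max_left _ _))
    L (fun x hx => hL x (Multiset.mem_coe.1 hx)) 1
    (by
      rw [ofMul_one, map_zero]
      exact ⟨min_le_of_left_le (neg_nonpos.2 hc0), le_max_of_le_left hc0⟩)
    (by rw [hsum]; exact ⟨min_le_right _ _, le_max_right _ _⟩)
  refine ⟨h, hh.trans hsum, fun I hI hcI hgI => hconn.mono ?_⟩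
  refine hI.out (min_rec' I (hcI ?_) hgI) (max_rec' I (hcI ?_) hgI) <;> constructor <;> linarith

theorem exists_generator_pos (hy : Subgroup.closure (Set.range y) = ⊤) (hχ : χ ≠ 0) :
    ∃ x ∈ Set.range y ∪ (Set.range y)⁻¹, 0 < χ (.ofMul x) := by
  by_contra! hle
  have hzero : ∀ i, χ (.ofMul (y i)) = 0 := fun i => by
    refine le_antisymm (hle _ (Or.inl ⟨i, rfl⟩)) ?_
    have := hle (y i)⁻¹ (Or.inr (Set.inv_mem_inv.2 ⟨i, rfl⟩))
    rwa [ofMul_inv, map_neg, neg_nonpos] at this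
  refine hχ (AddMonoidHom.ext fun a => ?_)
  have := eq_of_mul_generator_eq hy (F := fun g => χ (.ofMul g))
    (fun g i => by rw [ofMul_mul, map_add, hzero, add_zero]) a.toMul 1
  exact this.trans (map_zero χ)

theorem exists_heightConnected_Icc_ge (hy : Subgroup.closure (Set.range y) = ⊤) (hχ : χ ≠ 0)
    (c : ℝ) : ∃ t, c ≤ χ (.ofMul t) ∧ HeightConnected y χ (Set.Icc 0 (χ (.ofMul t))) 1 t := by
  obtain ⟨x, hx, hx0⟩ := exists_generator_pos hy hχ
  have hpow : ∀ n : ℕ, χ (.ofMul (x ^ n)) = n * χ (.ofMul x) := fun n => by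
    rw [ofMul_pow, map_nsmul, nsmul_eq_mul]
  have hnonneg : ∀ n : ℕ, 0 ≤ χ (.ofMul (x ^ n)) := fun n => by rw [hpow]; positivity
  have hpath : ∀ n : ℕ, HeightConnected y χ (Set.Icc 0 (χ (.ofMul (x ^ n)))) 1 (x ^ n) := by
    intro n
    induction n with
    | zero => rw [pow_zero]; exact refl 1
    | succ n ih =>
      have hle : χ (.ofMul (x ^ n)) ≤ χ (.ofMul (x ^ (n + 1))) := by
        rw [pow_succ, ofMul_mul, map_add]; linarith
      refine (ih.mono (Set.Icc_subset_Icc_right hle)).trans ?_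
      simp only [pow_succ] at hle ⊢
      exact mul_of_mem hx ⟨hnonneg n, hle⟩ ⟨(hnonneg n).trans hle, le_rfl⟩
  obtain ⟨n, hn⟩ := exists_nat_ge (c / χ (.ofMul x))
  exact ⟨x ^ n, (hpow n).symm ▸ (div_le_iff₀ hx0).1 hn, hpath n⟩

theorem exists_heightConnected_conj (hy : Subgroup.closure (Set.range y) = ⊤) (hχ : χ ≠ 0)
    (c : ℝ) (hg : 0 ≤ χ (.ofMul g)) :
    ∃ t, c ≤ χ (.ofMul t) ∧ HeightConnected y χ (Set.Icc 0 (χ (.ofMul t))) 1 t ∧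
      HeightConnected y χ (Set.Ici 0) 1 (t * g * t⁻¹) := by
  obtain ⟨M, hM⟩ := exists_heightConnected_Icc hy χ 1 g
  obtain ⟨t, hct, ht⟩ := exists_heightConnected_Icc_ge hy hχ (max c M)
  refine ⟨t, (le_max_left _ _).trans hct, ht, ?_⟩
  have htg : HeightConnected y χ (Set.Ici 0) t (t * g) := by
    have := hM.translate (J := Set.Ici 0) t fun s hs => by
      rw [Set.mem_Ici]; linarith [hs.1, (le_max_right _ _).trans hct]
    rwa [mul_one] at this
  have htgt : HeightConnected y χ (Set.Ici 0) (t * g * t⁻¹) (t * g) := by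
    have := ht.translate (J := Set.Ici 0) (t * g * t⁻¹) fun s hs => by
      simp only [ofMul_mul, ofMul_inv, map_add, map_neg, Set.mem_Ici]; linarith [hs.1]
    rwa [mul_one, inv_mul_cancel_right] at this
  exact ((ht.mono Set.Icc_subset_Ici_self).trans htg).trans htgt.symm

theorem halfCayleyGraph_connected_of_heightConnected
    (h : ∀ g, 0 ≤ χ (.ofMul g) → HeightConnected y χ (Set.Ici 0) 1 g) :
    (halfCayleyGraph y χ).Connected := by
  classical
  let component (g : H) : Option (halfCayleyGraph y χ).ConnectedComponent :=
    if hg : 0 ≤ χ (.ofMul g) then some (SimpleGraph.connectedComponentMk _ ⟨g, hg⟩) else none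
  have hedge : ∀ g i, 0 ≤ χ (.ofMul g) → 0 ≤ χ (.ofMul (g * y i)) →
      component g = component (g * y i) := by
    intro g i hg hgi
    by_cases hne : g = g * y i
    · rw [← hne]
    · have hadj : (halfCayleyGraph y χ).Adj ⟨g, hg⟩ ⟨g * y i, hgi⟩ :=
        (SimpleGraph.mulCayley_adj' _ _ _).2 ⟨hne, y i, ⟨i, rfl⟩, Or.inl rfl⟩
      simp only [component, dif_pos hg, dif_pos hgi, SimpleGraph.ConnectedComponent.sound
        hadj.reachable]
  have h1 : 0 ≤ χ (.ofMul (1 : H)) := (map_zero χ).ge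
  have hreach : ∀ g : {g : H | 0 ≤ χ (.ofMul g)}, (halfCayleyGraph y χ).Reachable ⟨1, h1⟩ g := by
    intro g
    have heq := (h g g.2).setoid_rel (Setoid.ker component) hedge
    rw [Setoid.ker_def] at heq
    simp only [component, dif_pos h1, dif_pos (show 0 ≤ χ (.ofMul g.1) from g.2)] at heq
    exact SimpleGraph.ConnectedComponent.exact (Option.some_injective _ heq)
  have : Nonempty {g : H | 0 ≤ χ (.ofMul g)} := ⟨⟨1, h1⟩⟩
  exact SimpleGraph.Connected.mk fun a b => (hreach a).symm.trans (hreach b)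

theorem halfCayleyGraph_connected_of_ker (hy : Subgroup.closure (Set.range y) = ⊤) (hχ : χ ≠ 0)
    (c : ℝ) (h : ∀ n, χ (.ofMul n) = 0 → HeightConnected y χ (Set.Ici (-c)) 1 n) :
    (halfCayleyGraph y χ).Connected := by
  refine halfCayleyGraph_connected_of_heightConnected fun g hg => ?_
  obtain ⟨t, hct, ht, htg⟩ := exists_heightConnected_conj hy hχ c hg
  replace ht := ht.mono Set.Icc_subset_Ici_self
  set n := g * (t * g * t⁻¹)⁻¹ with hn
  have hn0 : χ (.ofMul n) = 0 := by
    simp only [hn, ofMul_mul, ofMul_inv, map_add, map_neg]; ring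
  have htn : HeightConnected y χ (Set.Ici 0) t (n * t) := by
    have := (h (t⁻¹ * n * t) (by simp [hn0])).translate (J := Set.Ici 0) t fun s hs => by
      rw [Set.mem_Ici] at hs ⊢; linarith
    rwa [mul_one, ← mul_assoc, mul_inv_cancel_left] at this
  have h1n : HeightConnected y χ (Set.Ici 0) 1 n := by
    have := ht.translate_ker hn0
    rw [mul_one] at this
    exact (ht.trans htn).trans this.symm
  have hng := htg.translate_ker hn0
  rw [mul_one, inv_mul_cancel_right] at hng
  exact h1n.trans hng

theorem heightConnected_Iic_of_Ici (hy : Subgroup.closure (Set.range y) = ⊤) (hχ : χ ≠ 0)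
    {c c' : ℝ} (hc : 0 ≤ c) (hc' : 0 ≤ c')
    (h : ∀ n, χ (.ofMul n) = 0 → HeightConnected y χ (Set.Ici (-c)) 1 n →
      HeightConnected y χ (Set.Iic c') 1 n) {n : H} (hn : χ (.ofMul n) = 0) :
    HeightConnected y χ (Set.Iic c') 1 n := by
  obtain ⟨t, ht0, ht, htn⟩ := exists_heightConnected_conj hy hχ 0 hn.ge
  have hconj : HeightConnected y χ (Set.Iic c') 1 (t * n * t⁻¹) :=
    h _ (by simp [hn]) (htn.mono (Set.Ici_subset_Ici.2 (neg_nonpos.2 hc)))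
  have hdown : HeightConnected y χ (Set.Iic c') t⁻¹ (n * t⁻¹) := by
    have := hconj.translate (J := Set.Iic c') t⁻¹ fun s hs => by
      rw [Set.mem_Iic] at hs ⊢; simp only [ofMul_inv, map_neg]; linarith
    rwa [mul_one, mul_assoc, inv_mul_cancel_left] at this
  have ht' : HeightConnected y χ (Set.Iic c') t⁻¹ 1 := by
    have := ht.translate (J := Set.Iic c') t⁻¹ fun s hs => by
      rw [Set.mem_Iic]; simp only [ofMul_inv, map_neg]; linarith [hs.2]
    rwa [mul_one, inv_mul_cancel] at this
  have hnt := ht'.translate_ker hn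
  rw [mul_one] at hnt
  exact (ht'.symm.trans hdown).trans hnt

theorem exists_not_heightConnected_Ici {X : Type*} {η : X → H}
    (hη : Subgroup.closure (Set.range η) = ⊤) (hχ : χ ≠ 0)
    (hconn : ¬ (halfCayleyGraph η χ).Connected) [Finite Y] (y : Y → H) (c : ℝ) :
    ∃ n, χ (.ofMul n) = 0 ∧ ¬ HeightConnected y χ (Set.Ici c) 1 n := by
  obtain ⟨M, hM⟩ := exists_heightConnected_of_generators hη χ y
  by_contra! hcon
  refine hconn (halfCayleyGraph_connected_of_ker hη hχ (M - c) fun n hn => ?_)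
  refine hM (Set.Ici c) _ (fun t ht s hs => ?_) 1 n (hcon n hn)
  rw [Set.mem_Ici] at ht ⊢
  linarith [hs.1]

end HeightConnected

section Development

variable {H K P Q : Type*} [Group H] [Group K] [Group P] [Group Q] {Y : Type*}

/-- `D` develops the labelling `γ` of the edges of the Cayley graph of `H` with respect to `y`: it
sends `g` to the product of the labels along any path from `1` to `g`, where `γ g i` is the label of
the edge from `g` to `g * y i`. -/
structure IsDevelopment (y : Y → H) (γ : H → Y → P) (D : H → P) : Prop where
  map_one : D 1 = 1
  map_mul_generator : ∀ g i, D (g * y i) = D g * γ g i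

namespace IsDevelopment

variable {y : Y → H} {γ : H → Y → P} {D D' : H → P}

theorem eq (hy : Subgroup.closure (Set.range y) = ⊤) (hD : IsDevelopment y γ D)
    (hD' : IsDevelopment y γ D') : D = D' := by
  funext g
  have := eq_of_mul_generator_eq hy (F := fun g => D g * (D' g)⁻¹)
    (fun g i => by simp only [hD.map_mul_generator, hD'.map_mul_generator]; group) g 1
  rwa [hD.map_one, hD'.map_one, inv_one, mul_one, mul_inv_eq_one] at this

theorem map_mul (hy : Subgroup.closure (Set.range y) = ⊤) (hD : IsDevelopment y γ D) {n : H}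
    (hn : ∀ g i, γ (n * g) i = γ g i) (g : H) : D (n * g) = D n * D g := by
  have hshift : IsDevelopment y γ fun g => (D n)⁻¹ * D (n * g) :=
    ⟨by rw [mul_one, inv_mul_cancel], fun g i => by
      rw [← mul_assoc, hD.map_mul_generator, hn, mul_assoc]⟩
  rw [congrFun (hD.eq hy hshift) g, mul_inv_cancel_left]

theorem comp_left (hD : IsDevelopment y γ D) (θ : P →* Q) :
    IsDevelopment y (fun g i => θ (γ g i)) (θ ∘ D) :=
  ⟨by simp only [Function.comp_apply, hD.map_one, _root_.map_one],
    fun g i => by simp only [Function.comp_apply, hD.map_mul_generator, _root_.map_mul]⟩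

theorem comp_right {f : K →* H} {z : Y → K} (hD : IsDevelopment (f ∘ z) γ D) :
    IsDevelopment z (fun w => γ (f w)) (D ∘ f) :=
  ⟨by simp only [Function.comp_apply, _root_.map_one, hD.map_one], fun w i => by
    simpa only [Function.comp_apply, _root_.map_mul] using hD.map_mul_generator (f w) i⟩

theorem inv_mul_mem (hD : IsDevelopment y γ D) {χ : Character H} {I : Set ℝ} {T : Subgroup P}
    (hT : ∀ g i, χ (.ofMul g) ∈ I → χ (.ofMul (g * y i)) ∈ I → γ g i ∈ T) {g h : H}
    (hgh : HeightConnected y χ I g h) : (D g)⁻¹ * D h ∈ T := by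
  rw [← QuotientGroup.leftRel_apply]
  refine hgh.setoid_rel ((QuotientGroup.leftRel T).comap D) fun a i ha hai => ?_
  rw [Setoid.comap_rel, QuotientGroup.leftRel_apply, hD.map_mul_generator, inv_mul_cancel_left]
  exact hT a i ha hai

end IsDevelopment

/-- Crossing the edge from `w` to `w * i` multiplies by its label on the right; this is a bijection
of `FreeGroup Y × P`, so these bijections define an action of the free group. -/
theorem exists_isDevelopment_freeGroup (γ : FreeGroup Y → Y → P) :
    ∃ D, IsDevelopment FreeGroup.of γ D := by
  let cross (i : Y) : Equiv.Perm (FreeGroup Y × P) :=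
    { toFun := fun p => (p.1 * .of i, p.2 * γ p.1 i)
      invFun := fun p => (p.1 * (.of i)⁻¹, p.2 * (γ (p.1 * (.of i)⁻¹) i)⁻¹)
      left_inv := fun p => by simp
      right_inv := fun p => by simp }
  let act : FreeGroup Y →* (Equiv.Perm (FreeGroup Y × P))ᵐᵒᵖ :=
    FreeGroup.lift fun i => .op (cross i)
  let walk (w : FreeGroup Y) : FreeGroup Y × P := (act w).unop (1, 1)
  have hwalk_one : walk 1 = (1, 1) := by simp [walk]
  have hwalk : ∀ w i, walk (w * .of i) = cross i (walk w) := fun w i => by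
    simp [walk, act, Equiv.Perm.mul_apply]
  have hfst : ∀ w, (walk w).1 = w := fun w => by
    have := eq_of_mul_generator_eq (FreeGroup.closure_range_of Y) (F := fun w => (walk w).1 * w⁻¹)
      (fun w i => by simp [hwalk, cross]) w 1
    rwa [hwalk_one, inv_one, mul_one, mul_inv_eq_one] at this
  refine ⟨fun w => (walk w).2, congrArg Prod.snd hwalk_one, fun w i => ?_⟩
  simp only [hwalk, cross, Equiv.coe_fn_mk, hfst]

theorem IsDevelopment.exists_of_normalClosure_eq_ker {f : K →* H} (hf : Function.Surjective f)
    {R : Set K} (hR : Subgroup.normalClosure R = f.ker) {z : Y → K}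
    (hz : Subgroup.closure (Set.range z) = ⊤) {γ : H → Y → P} {D : K → P}
    (hD : IsDevelopment z (fun w => γ (f w)) D) (hDR : ∀ r ∈ R, ∀ u, D (u * r) = D u) :
    ∃ D', IsDevelopment (f ∘ z) γ D' := by
  have hmul : ∀ m ∈ f.ker, ∀ w, D (m * w) = D m * D w := fun m hm =>
    hD.map_mul hz fun w i => by rw [_root_.map_mul, MonoidHom.mem_ker.1 hm, one_mul]
  have hker : ∀ m ∈ f.ker, D m = 1 := by
    intro m hm
    rw [← hR] at hm
    induction hm using Subgroup.closure_induction with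
    | mem m hm =>
      have hmR : m ∈ f.ker := hR ▸ Subgroup.subset_closure hm
      obtain ⟨r, hr, u, rfl⟩ := Group.mem_conjugatesOfSet_iff.1 hm |>.imp
        fun r h => h.imp_right isConj_iff.1
      have := hmul _ hmR u
      rw [inv_mul_cancel_right, hDR r hr u] at this
      exact right_eq_mul.1 this
    | one => exact hD.map_one
    | mul a b ha _ iha ihb => rw [hmul a (hR ▸ ha), iha, ihb, one_mul]
    | inv a ha iha =>
      have := hmul a (hR ▸ ha) a⁻¹
      rwa [mul_inv_cancel, hD.map_one, iha, one_mul, eq_comm] at this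
  have hfibre : ∀ u v, f u = f v → D u = D v := fun u v huv => by
    have huv' : u * v⁻¹ ∈ f.ker := by rw [MonoidHom.mem_ker, map_mul_inv, huv, mul_inv_cancel]
    rw [← inv_mul_cancel_right u v, hmul _ huv', hker _ huv', one_mul]
  refine ⟨D ∘ Function.surjInv hf, ?_, fun g i => ?_⟩
  · exact (hfibre _ 1 (by rw [Function.surjInv_eq hf, _root_.map_one])).trans hD.map_one
  · refine (hfibre _ (Function.surjInv hf g * z i) ?_).trans ?_
    · rw [Function.surjInv_eq hf, _root_.map_mul, Function.surjInv_eq hf, Function.comp_apply]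
    · rw [hD.map_mul_generator, Function.surjInv_eq hf, Function.comp_apply]

end Development

section HeightSubgroup

variable {G : Type*} [Group G] {Y : Type*}

theorem apply_ker {χ : Character G} (n : characterKer χ) : χ (.ofMul n.1) = 0 := n.2

/-- The elements of the kernel of `χ` that can be reached from `1` by paths with heights in `I`. -/
def heightSubgroup (y : Y → G) (χ : Character G) (I : Set ℝ) : Subgroup (characterKer χ) where
  carrier := {n | HeightConnected y χ I 1 n}
  one_mem' := .refl 1
  mul_mem' {m n} hm hn := by
    have hmn := HeightConnected.translate_ker (apply_ker m) hn
    rw [mul_one] at hmn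
    exact HeightConnected.trans hm hmn
  inv_mem' {n} hn := by
    have hinv := HeightConnected.translate_ker (apply_ker n⁻¹) hn
    rw [mul_one, Subgroup.coe_inv, inv_mul_cancel] at hinv
    exact hinv.symm

theorem mem_heightSubgroup {y : Y → G} {χ : Character G} {I : Set ℝ} {n : characterKer χ} :
    n ∈ heightSubgroup y χ I ↔ HeightConnected y χ I 1 n :=
  Iff.rfl

theorem heightSubgroup_mono (y : Y → G) (χ : Character G) : Monotone (heightSubgroup y χ) :=
  fun _ _ hIJ _ hn => HeightConnected.mono hIJ hn

/-- The upper (`true`) and the lower (`false`) half line, overlapping in `[-c, c]`. -/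
def halfLine (c : ℝ) (b : Bool) : Set ℝ := cond b (Set.Ici (-c)) (Set.Iic c)

theorem halfLine_inter_halfLine {b b' : Bool} (hb : b ≠ b') (c : ℝ) :
    halfLine c b ∩ halfLine c b' = Set.Icc (-c) c := by
  cases b <;> cases b'
  · exact absurd rfl hb
  · exact (Set.inter_comm _ _).trans Set.Ici_inter_Iic
  · exact Set.Ici_inter_Iic
  · exact absurd rfl hb

theorem ordConnected_halfLine (c : ℝ) (b : Bool) : (halfLine c b).OrdConnected := by
  cases b
  · exact Set.ordConnected_Iic
  · exact Set.ordConnected_Ici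

theorem Icc_subset_halfLine (c : ℝ) (b : Bool) : Set.Icc (-c) c ⊆ halfLine c b := by
  cases b
  · exact Set.Icc_subset_Iic_self
  · exact Set.Icc_subset_Ici_self

theorem monotone_halfLine (b : Bool) : Monotone (halfLine · b) := by
  intro c c' hc
  cases b
  · exact Set.Iic_subset_Iic.2 hc
  · exact Set.Ici_subset_Ici.2 (neg_le_neg hc)

theorem exists_add_mem_halfLine (c s : ℝ) :
    ∃ b, ∀ t ∈ Set.Icc (-c) c, s + t ∈ halfLine c b := by
  rcases le_total 0 s with hs | hs
  · exact ⟨true, fun t ht => show -c ≤ s + t by linarith [ht.1]⟩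
  · exact ⟨false, fun t ht => show s + t ≤ c by linarith [ht.2]⟩

theorem heightSubgroup_Icc_le_halfLine (y : Y → G) (χ : Character G) (c : ℝ) (b : Bool) :
    heightSubgroup y χ (Set.Icc (-c) c) ≤ heightSubgroup y χ (halfLine c b) :=
  heightSubgroup_mono y χ (Icc_subset_halfLine c b)

end HeightSubgroup

section Amalgam

variable {ι N : Type*} [Group N] {S : Subgroup N} {A : ι → Subgroup N} {hSA : ∀ i, S ≤ A i}

variable (S A hSA) in
/-- The free product of the subgroups `A i` of `N` amalgamated along `S`. -/
abbrev Amalgam : Type _ := Monoid.PushoutI fun i => Subgroup.inclusion (hSA i)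

variable (hSA) in
/-- The factor `A i` of the amalgam, embedded in it. -/
abbrev amalgamFactor (i : ι) : Subgroup (Amalgam S A hSA) :=
  (Monoid.PushoutI.of (φ := fun i => Subgroup.inclusion (hSA i)) i).range

theorem injOn_amalgamMap_factor (i : ι) :
    Set.InjOn (amalgamMap S A hSA) (amalgamFactor hSA i) := by
  rintro _ ⟨a, rfl⟩ _ ⟨a', rfl⟩ haa'
  rw [amalgamMap_of, amalgamMap_of] at haa'
  rw [Subtype.ext haa']

theorem eq_of_inv_mul_mem_factor {p q : Amalgam S A hSA} {i : ι}
    (hpq : p⁻¹ * q ∈ amalgamFactor hSA i) (h : amalgamMap S A hSA p = amalgamMap S A hSA q) :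
    p = q :=
  inv_mul_eq_one.1 <| injOn_amalgamMap_factor i hpq (one_mem _) <| by
    rw [map_mul, map_inv, h, inv_mul_cancel, map_one]

theorem exists_amalgamMap_eq {n : N} {s : Set ι} (hs : s.Nonempty) (hA : ∀ i ∈ s, n ∈ A i)
    (hS : s.Pairwise fun _ _ => n ∈ S) :
    ∃ p : Amalgam S A hSA, amalgamMap S A hSA p = n ∧ ∀ i ∈ s, p ∈ amalgamFactor hSA i := by
  obtain ⟨i, hi⟩ := hs
  refine ⟨Monoid.PushoutI.of i ⟨n, hA i hi⟩, amalgamMap_of _ _ _ _ _, fun j hj => ?_⟩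
  rcases eq_or_ne i j with rfl | hij
  · exact ⟨_, rfl⟩
  · have hbase : ∀ k, Monoid.PushoutI.of k (Subgroup.inclusion (hSA k) ⟨n, hS hi hj hij⟩) =
        Monoid.PushoutI.base (fun i => Subgroup.inclusion (hSA i)) ⟨n, hS hi hj hij⟩ :=
      fun k => Monoid.PushoutI.of_apply_eq_base _ k _
    exact ⟨_, (hbase j).trans (hbase i).symm⟩

end Amalgam

section HeightSection

variable {G : Type*} [Group G] {Y : Type*}

/-- `σ` picks, for each value `s` of `χ`, an element `σ s` of height `s` that is joined to `1` by
paths keeping to any given interval around `[-c, c]` that contains `s`. -/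
structure IsHeightSection (y : Y → G) (χ : Character G) (c : ℝ) (σ : ℝ → G) : Prop where
  map_zero : σ 0 = 1
  apply_map : ∀ g, χ (.ofMul (σ (χ (.ofMul g)))) = χ (.ofMul g)
  heightConnected : ∀ (g : G) (I : Set ℝ), I.OrdConnected → Set.Icc (-c) c ⊆ I →
    χ (.ofMul g) ∈ I → HeightConnected y χ I 1 (σ (χ (.ofMul g)))

theorem exists_isHeightSection {y : Y → G} (hy : Subgroup.closure (Set.range y) = ⊤)
    {χ : Character G} {c : ℝ} (hc0 : 0 ≤ c) (hc : ∀ i, |χ (.ofMul (y i))| ≤ c) :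
    ∃ σ, IsHeightSection y χ c σ := by
  classical
  choose h hχ hconn using exists_heightConnected_one hy hc0 hc
  let pick (s : ℝ) : G := if hs : ∃ g, χ (.ofMul g) = s then h hs.choose else 1
  have hpick : ∀ g, ∃ g', χ (.ofMul g') = χ (.ofMul g) ∧ pick (χ (.ofMul g)) = h g' := fun g =>
    have hg : ∃ g', χ (.ofMul g') = χ (.ofMul g) := ⟨g, rfl⟩
    ⟨hg.choose, hg.choose_spec, dif_pos hg⟩
  refine ⟨Function.update pick 0 1, Function.update_self .., fun g => ?_, fun g I hI hcI hg => ?_⟩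
  all_goals rcases eq_or_ne (χ (.ofMul g)) 0 with hg0 | hg0
  · rw [hg0, Function.update_self, ofMul_one, map_zero]
  · obtain ⟨g', hg', heq⟩ := hpick g
    rw [Function.update_of_ne hg0, heq, hχ, hg']
  · rw [hg0, Function.update_self]
    exact .refl 1
  · obtain ⟨g', hg', heq⟩ := hpick g
    rw [Function.update_of_ne hg0, heq]
    exact hconn g' I hI hcI (hg' ▸ hg)

namespace IsHeightSection

variable {y : Y → G} {χ : Character G} {c : ℝ} {σ : ℝ → G}

/-- The element `σ (χ g) * y i * (σ (χ (g * y i)))⁻¹` of the kernel: the Schreier generator, for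
the transversal `σ` of the kernel, of the edge from `g` to `g * y i`. -/
def loop (hσ : IsHeightSection y χ c σ) (g : G) (i : Y) : characterKer χ :=
  ⟨σ (χ (.ofMul g)) * y i * (σ (χ (.ofMul (g * y i))))⁻¹, by
    change χ (.ofMul (σ (χ (.ofMul g)) * y i * (σ (χ (.ofMul (g * y i))))⁻¹)) = 0
    simp only [ofMul_mul, ofMul_inv, map_add, map_neg]
    rw [hσ.apply_map, ← map_add, ← ofMul_mul, hσ.apply_map, add_neg_cancel]⟩

variable (hσ : IsHeightSection y χ c σ)

theorem coe_loop (g : G) (i : Y) :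
    (hσ.loop g i : G) = σ (χ (.ofMul g)) * y i * (σ (χ (.ofMul (g * y i))))⁻¹ :=
  rfl

include hσ in
theorem apply_map_mul (g : G) (i : Y) :
    χ (.ofMul (σ (χ (.ofMul g)) * y i)) = χ (.ofMul (g * y i)) := by
  simp only [ofMul_mul, map_add, hσ.apply_map]

theorem loop_map (g : G) (i : Y) : hσ.loop (σ (χ (.ofMul g))) i = hσ.loop g i :=
  Subtype.ext <| by rw [coe_loop, coe_loop, hσ.apply_map, hσ.apply_map_mul]

theorem loop_mem {I : Set ℝ} (hI : I.OrdConnected) (hcI : Set.Icc (-c) c ⊆ I) {g : G} {i : Y}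
    (hg : χ (.ofMul g) ∈ I) (hgi : χ (.ofMul (g * y i)) ∈ I) :
    hσ.loop g i ∈ heightSubgroup y χ I := by
  have hto := hσ.heightConnected g I hI hcI hg
  have hacross : HeightConnected y χ I (σ (χ (.ofMul g))) (σ (χ (.ofMul g)) * y i) :=
    .edge (by rwa [hσ.apply_map]) (by rwa [hσ.apply_map_mul])
  have hback := (hσ.heightConnected (g * y i) I hI hcI hgi).translate_ker
    (apply_ker (hσ.loop g i))
  rw [mul_one, coe_loop, inv_mul_cancel_right] at hback
  exact (hto.trans hacross).trans hback.symm

theorem isDevelopment_loop :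
    IsDevelopment y (fun g i => (hσ.loop g i : G)) fun g => g * (σ (χ (.ofMul g)))⁻¹ :=
  ⟨by rw [ofMul_one, _root_.map_zero, hσ.map_zero, inv_one, mul_one],
    fun g i => by rw [coe_loop]; group⟩

end IsHeightSection

/-- The free product of the subgroups of loops in the two half spaces `{-c ≤ χ}` and `{χ ≤ c}`,
amalgamated along the subgroup of loops in the strip `{-c ≤ χ ≤ c}`. -/
abbrev HalfAmalgam (y : Y → G) (χ : Character G) (c : ℝ) : Type _ :=
  Amalgam _ _ (heightSubgroup_Icc_le_halfLine y χ c)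

/-- The map from the amalgam of the two half spaces to the kernel of `χ` induced by the
inclusions. -/
noncomputable abbrev halfAmalgamMap (y : Y → G) (χ : Character G) (c : ℝ) :
    HalfAmalgam y χ c →* characterKer χ :=
  amalgamMap _ _ (heightSubgroup_Icc_le_halfLine y χ c)

variable {y : Y → G} {χ : Character G} {c : ℝ} {σ : ℝ → G}

/-- `γ` lifts the loops of the edges to the amalgam of the two half spaces, in a way that is
invariant under the kernel and labels the edges of each half space by its factor. -/
structure IsLoopLabelling (hσ : IsHeightSection y χ c σ) (γ : G → Y → HalfAmalgam y χ c) :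
    Prop where
  ker_mul : ∀ n, χ (.ofMul n) = 0 → ∀ g i, γ (n * g) i = γ g i
  map_eq : ∀ g i, halfAmalgamMap y χ c (γ g i) = hσ.loop g i
  mem_factor : ∀ g i b, χ (.ofMul g) ∈ halfLine c b → χ (.ofMul (g * y i)) ∈ halfLine c b →
    γ g i ∈ amalgamFactor (heightSubgroup_Icc_le_halfLine y χ c) b

theorem exists_isLoopLabelling (hσ : IsHeightSection y χ c σ)
    (hc0 : 0 ≤ c) (hc : ∀ i, |χ (.ofMul (y i))| ≤ c) : ∃ γ, IsLoopLabelling hσ γ := by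
  let sides (g : G) (i : Y) : Set Bool :=
    {b | χ (.ofMul g) ∈ halfLine c b ∧ χ (.ofMul (g * y i)) ∈ halfLine c b}
  have hsides : ∀ g i, (sides g i).Nonempty := fun g i => by
    obtain ⟨b, hb⟩ := exists_add_mem_halfLine c (χ (.ofMul g))
    refine ⟨b, ?_, ?_⟩
    · simpa only [add_zero] using hb 0 ⟨neg_nonpos.2 hc0, hc0⟩
    · simpa only [ofMul_mul, map_add] using hb _ (abs_le.1 (hc i))
  have hlift : ∀ g i, ∃ p, halfAmalgamMap y χ c p = hσ.loop g i ∧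
      ∀ b ∈ sides g i, p ∈ amalgamFactor (heightSubgroup_Icc_le_halfLine y χ c) b := fun g i =>
    exists_amalgamMap_eq (hsides g i)
      (fun b hb => hσ.loop_mem (ordConnected_halfLine c b) (Icc_subset_halfLine c b) hb.1 hb.2)
      fun b hb b' hb' hne => hσ.loop_mem Set.ordConnected_Icc subset_rfl
        (halfLine_inter_halfLine hne c ▸ ⟨hb.1, hb'.1⟩)
        (halfLine_inter_halfLine hne c ▸ ⟨hb.2, hb'.2⟩)
  choose γ hγ hγ_mem using hlift
  -- Reading the label at `σ (χ g)` instead of `g` makes it depend on `χ g` only.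
  refine ⟨fun g i => γ (σ (χ (.ofMul g))) i, fun n hn g i => ?_, fun g i => ?_,
    fun g i b hg hgi => hγ_mem _ i b ⟨?_, ?_⟩⟩
  · rw [ofMul_mul, map_add, hn, zero_add]
  · rw [hγ, hσ.loop_map]
  · rwa [hσ.apply_map]
  · rwa [hσ.apply_map_mul]

section Presentation

variable {K : Type*} [Group K] {f : K →* G} {z : Y → K}
  {hσ : IsHeightSection (f ∘ z) χ c σ} {γ : G → Y → HalfAmalgam (f ∘ z) χ c}
  {D : K → HalfAmalgam (f ∘ z) χ c}

namespace IsLoopLabelling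

theorem coe_map_development (hγ : IsLoopLabelling hσ γ)
    (hz : Subgroup.closure (Set.range z) = ⊤)
    (hD : IsDevelopment z (fun w => γ (f w)) D) (w : K) :
    (halfAmalgamMap (f ∘ z) χ c (D w) : G) = f w * (σ (χ (.ofMul (f w))))⁻¹ := by
  have hΘD := hD.comp_left ((characterKer χ).subtype.comp (halfAmalgamMap (f ∘ z) χ c))
  simp only [MonoidHom.comp_apply, hγ.map_eq] at hΘD
  exact congrFun (hΘD.eq hz hσ.isDevelopment_loop.comp_right) w

theorem inv_mul_mem_factor (hγ : IsLoopLabelling hσ γ)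
    (hD : IsDevelopment z (fun w => γ (f w)) D) {b : Bool} {u v : K}
    (huv : HeightConnected z (χ.comp f.toAdditive) (halfLine c b) u v) :
    (D u)⁻¹ * D v ∈ amalgamFactor (heightSubgroup_Icc_le_halfLine (f ∘ z) χ c) b :=
  hD.inv_mul_mem (fun w i hw hwi => hγ.mem_factor _ i b hw (by
    rw [Function.comp_apply, ← map_mul]; exact hwi)) huv

theorem development_eq (hγ : IsLoopLabelling hσ γ) (hz : Subgroup.closure (Set.range z) = ⊤)
    (hD : IsDevelopment z (fun w => γ (f w)) D) {b : Bool} {u v : K}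
    (huv : HeightConnected z (χ.comp f.toAdditive) (halfLine c b) u v)
    (hf : f u = f v) : D u = D v :=
  eq_of_inv_mul_mem_factor (hγ.inv_mul_mem_factor hD huv) <| Subtype.ext <| by
    rw [hγ.coe_map_development hz hD, hγ.coe_map_development hz hD, hf]

theorem exists_isDevelopment {f : FreeGroup Y →* G} (hf : Function.Surjective f)
    {R : Set (FreeGroup Y)} (hR : Subgroup.normalClosure R = f.ker)
    (hRc : ∀ r ∈ R,
      HeightConnected FreeGroup.of (χ.comp f.toAdditive) (Set.Icc (-c) c) 1 r)
    {hσ : IsHeightSection (f ∘ FreeGroup.of) χ c σ}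
    {γ : G → Y → HalfAmalgam (f ∘ FreeGroup.of) χ c} (hγ : IsLoopLabelling hσ γ) :
    ∃ D, IsDevelopment (f ∘ FreeGroup.of) γ D := by
  obtain ⟨D, hD⟩ := exists_isDevelopment_freeGroup fun w => γ (f w)
  refine hD.exists_of_normalClosure_eq_ker hf hR (FreeGroup.closure_range_of Y) fun r hr u => ?_
  have hfr : f r = 1 := MonoidHom.mem_ker.1 (hR ▸ Subgroup.subset_normalClosure hr)
  obtain ⟨b, hb⟩ := exists_add_mem_halfLine c (χ (.ofMul (f u)))
  have hru := (hRc r hr).translate u (J := halfLine c b) fun t ht => hb t ht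
  rw [mul_one] at hru
  exact (hγ.development_eq (FreeGroup.closure_range_of Y) hD hru (by
    rw [map_mul, hfr, mul_one])).symm

end IsLoopLabelling

end Presentation

theorem IsLoopLabelling.bijective_halfAmalgamMap {hσ : IsHeightSection y χ c σ}
    {γ : G → Y → HalfAmalgam y χ c} (hγ : IsLoopLabelling hσ γ)
    (hy : Subgroup.closure (Set.range y) = ⊤) {D : G → HalfAmalgam y χ c}
    (hD : IsDevelopment y γ D) : Function.Bijective (halfAmalgamMap y χ c) := by
  let Λ : characterKer χ →* HalfAmalgam y χ c :=
    { toFun := fun n => D n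
      map_one' := hD.map_one
      map_mul' := fun m n => hD.map_mul hy (hγ.ker_mul m (apply_ker m)) n }
  have hΘΛ : ∀ n, halfAmalgamMap y χ c (Λ n) = n := fun n => Subtype.ext <| by
    have := hγ.coe_map_development (f := MonoidHom.id G) hy hD n
    rwa [MonoidHom.id_apply, apply_ker, hσ.map_zero, inv_one, mul_one] at this
  have hΛΘ : Λ.comp (halfAmalgamMap y χ c) = MonoidHom.id _ := by
    refine Monoid.PushoutI.hom_ext_nonempty fun b => MonoidHom.ext fun a => ?_
    have hΛa : Λ a ∈ amalgamFactor (heightSubgroup_Icc_le_halfLine y χ c) b := by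
      have := hγ.inv_mul_mem_factor (f := MonoidHom.id G) hD (mem_heightSubgroup.1 a.2)
      rwa [hD.map_one, inv_one, one_mul] at this
    refine injOn_amalgamMap_factor b ?_ ⟨a, rfl⟩ (hΘΛ _)
    rwa [MonoidHom.comp_apply, MonoidHom.comp_apply, amalgamMap_of]
  exact ⟨Function.LeftInverse.injective (g := Λ) (DFunLike.congr_fun hΛΘ),
    Function.RightInverse.surjective hΘΛ⟩

theorem bijective_halfAmalgamMap {f : FreeGroup Y →* G} (hf : Function.Surjective f)
    {R : Set (FreeGroup Y)} (hR : Subgroup.normalClosure R = f.ker) (χ : Character G) {c : ℝ}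
    (hc0 : 0 ≤ c) (hc : ∀ i, |χ (.ofMul (f (.of i)))| ≤ c)
    (hRc : ∀ r ∈ R,
      HeightConnected FreeGroup.of (χ.comp f.toAdditive) (Set.Icc (-c) c) 1 r) :
    Function.Bijective (halfAmalgamMap (f ∘ FreeGroup.of) χ c) := by
  have hy : Subgroup.closure (Set.range (f ∘ FreeGroup.of)) = ⊤ :=
    closure_range_comp hf (FreeGroup.closure_range_of Y)
  obtain ⟨σ, hσ⟩ := exists_isHeightSection hy hc0 hc
  obtain ⟨γ, hγ⟩ := exists_isLoopLabelling hσ hc0 hc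
  obtain ⟨D, hD⟩ := IsLoopLabelling.exists_isDevelopment hf hR hRc hγ
  exact hγ.bijective_halfAmalgamMap hy hD

end HeightSection

section FreeSubgroup

variable {κ N : Type*} [Group N] {S : Subgroup N} {A : κ → Subgroup N}

/-- `g` is a product of elements of the subgroups `A k` that lie outside `S`, neighbouring ones
coming from different subgroups, the first one from `A i` and the last one from `A j`. -/
inductive IsAlternating (S : Subgroup N) (A : κ → Subgroup N) : κ → κ → N → Prop
  | of_mem {i : κ} {g : N} (hg : g ∈ A i) (hS : g ∉ S) : IsAlternating S A i i g
  | mul {i j k l : κ} {g h : N} (hg : IsAlternating S A i j g) (hjk : j ≠ k)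
      (hh : IsAlternating S A k l h) : IsAlternating S A i l (g * h)

namespace IsAlternating

theorem inv {i j : κ} {g : N} (hg : IsAlternating S A i j g) : IsAlternating S A j i g⁻¹ := by
  induction hg with
  | of_mem hg hS => exact .of_mem (inv_mem hg) (by rwa [inv_mem_iff])
  | mul _ hjk _ ihg ihh =>
    rw [mul_inv_rev]
    exact .mul ihh hjk.symm ihg

theorem exists_neWord (hSA : ∀ i, S ≤ A i) {i j : κ} {g : N} (hg : IsAlternating S A i j g) :
    ∃ w : Monoid.CoprodI.NeWord (fun i => A i) i j,
      Monoid.PushoutI.Reduced (fun i => Subgroup.inclusion (hSA i)) w.toWord ∧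
      amalgamMap S A hSA (Monoid.PushoutI.ofCoprodI w.prod) = g := by
  induction hg with
  | @of_mem i g hg hS =>
    have hg1 : (⟨g, hg⟩ : A i) ≠ 1 := fun h => hS <| by
      rw [show g = 1 from congrArg Subtype.val h]
      exact one_mem S
    refine ⟨.singleton ⟨g, hg⟩ hg1, fun l hl => ?_, ?_⟩
    · rw [List.mem_singleton.1 hl]
      rintro ⟨s, hs⟩
      have hsg : (s : N) = g := congrArg Subtype.val hs
      exact hS (hsg ▸ s.2)
    · rw [Monoid.CoprodI.NeWord.prod_singleton, Monoid.PushoutI.ofCoprodI_of, amalgamMap_of]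
  | mul _ hjk _ ihg ihh =>
    obtain ⟨v, hv, rfl⟩ := ihg
    obtain ⟨w, hw, rfl⟩ := ihh
    refine ⟨v.append hjk w, fun l hl => (List.mem_append.1 hl).elim (hv l) (hw l), ?_⟩
    rw [Monoid.CoprodI.NeWord.append_prod, map_mul, map_mul]

theorem ne_one {hSA : ∀ i, S ≤ A i} (hinj : Function.Injective (amalgamMap S A hSA)) {i j : κ}
    {g : N} (hg : IsAlternating S A i j g) : g ≠ 1 := by
  rintro rfl
  obtain ⟨w, hw, hw1⟩ := hg.exists_neWord hSA
  have hprod : Monoid.PushoutI.ofCoprodI w.prod = 1 := hinj (hw1.trans (map_one _).symm)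
  have hempty := hw.eq_empty_of_mem_range (fun i => Subgroup.inclusion_injective (hSA i))
    (hprod ▸ one_mem _)
  exact w.toList_ne_nil (congrArg Monoid.CoprodI.Word.toList hempty)

variable {i₀ i₁ : κ} {a b b' : N}

theorem pow_succ (hi : i₀ ≠ i₁) (hb : IsAlternating S A i₀ i₀ b) (ha : IsAlternating S A i₁ i₁ a)
    (hb' : IsAlternating S A i₀ i₀ b') (hbb' : IsAlternating S A i₀ i₀ (b' * b)) (n : ℕ) :
    IsAlternating S A i₀ i₀ ((b * a * b') ^ (n + 1)) := by
  obtain ⟨q, hq, heq⟩ : ∃ q, IsAlternating S A i₁ i₁ q ∧ (b * a * b') ^ (n + 1) = b * q * b' := by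
    induction n with
    | zero => exact ⟨a, ha, pow_one _⟩
    | succ n ih =>
      obtain ⟨q, hq, heq⟩ := ih
      refine ⟨q * (b' * b) * a, (hq.mul hi.symm hbb').mul hi ha, ?_⟩
      rw [_root_.pow_succ, heq]
      group
  rw [heq]
  exact (hb.mul hi hq).mul hi.symm hb'

theorem zpow (hi : i₀ ≠ i₁) (hb : IsAlternating S A i₀ i₀ b) (ha : IsAlternating S A i₁ i₁ a)
    (hb' : IsAlternating S A i₀ i₀ b') (hbb' : IsAlternating S A i₀ i₀ (b' * b)) {n : ℤ}
    (hn : n ≠ 0) : IsAlternating S A i₀ i₀ ((b * a * b') ^ n) := by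
  rcases n with (_ | n) | n
  · exact absurd rfl hn
  · rw [Int.ofNat_eq_natCast, zpow_natCast]
    exact hb.pow_succ hi ha hb' hbb' n
  · rw [zpow_negSucc]
    exact (hb.pow_succ hi ha hb' hbb' n).inv

end IsAlternating

open scoped Pointwise in
theorem injective_freeGroupLift_conj {hSA : ∀ i, S ≤ A i}
    (hinj : Function.Injective (amalgamMap S A hSA)) {i₀ i₁ : κ} (hi : i₀ ≠ i₁) {z : N}
    (hz : ∀ n : ℤ, n ≠ 0 → IsAlternating S A i₀ i₀ (z ^ n)) {P : Type} [Nontrivial P] {s : P → N}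
    (hs : Pairwise fun p q => IsAlternating S A i₁ i₁ ((s p)⁻¹ * s q)) :
    Function.Injective (FreeGroup.lift fun p => s p * z * (s p)⁻¹) := by
  let f (p : P) : FreeGroup Unit →* N := FreeGroup.lift fun _ => s p * z * (s p)⁻¹
  let X (p : P) : Set N := {g | ∃ j, IsAlternating S A i₀ j ((s p)⁻¹ * g)}
  have hlift : FreeGroup.lift (fun p => s p * z * (s p)⁻¹) =
      (Monoid.CoprodI.lift f).comp freeGroupEquivCoprodI.toMonoidHom := by
    ext p
    simp [f]
  rw [hlift, MonoidHom.coe_comp]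
  refine Function.Injective.comp (Monoid.CoprodI.lift_injective_of_ping_pong f (.inr ?_) X
    (fun p => ?_) (fun p q hpq => Set.disjoint_left.2 ?_) fun p q hpq w hw => ?_)
    freeGroupEquivCoprodI.injective
  · obtain ⟨p⟩ := Nontrivial.to_nonempty (α := P)
    have hcard : (3 : Cardinal) ≤ Cardinal.mk (FreeGroup Unit) := by
      rw [← Cardinal.mk_congr FreeGroup.freeGroupUnitEquivInt.symm]
      exact (Cardinal.natCast_le_aleph0 (n := 3)).trans (Cardinal.aleph0_le_mk _)
    exact ⟨p, hcard⟩
  · exact ⟨s p * z, i₀, by simpa using hz 1 one_ne_zero⟩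
  · rintro g ⟨j, hg⟩ ⟨k, hg'⟩
    exact ((hg.inv.mul hi (hs hpq)).mul hi.symm hg').ne_one hinj (by group)
  · obtain ⟨n, rfl⟩ := FreeGroup.freeGroupUnitEquivInt.symm.surjective w
    have hn : n ≠ 0 := by
      rintro rfl
      exact hw rfl
    have hfn : f p (FreeGroup.freeGroupUnitEquivInt.symm n) = s p * z ^ n * (s p)⁻¹ := by
      simp [f, FreeGroup.freeGroupUnitEquivInt, conj_zpow]
    rw [hfn, Set.smul_set_subset_iff]
    rintro g ⟨j, hg⟩
    refine ⟨j, ?_⟩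
    rw [show (s p)⁻¹ * ((s p * z ^ n * (s p)⁻¹) • g) = z ^ n * ((s p)⁻¹ * s q) * ((s q)⁻¹ * g) by
      rw [smul_eq_mul]; group]
    exact ((hz n hn).mul hi (hs hpq)).mul hi.symm hg

theorem hasNonabelianFreeSubgroup_of_injective {N : Type u} [Group N] (F : FreeGroup Bool →* N)
    (hF : Function.Injective F) : HasNonabelianFreeSubgroup N := by
  refine ⟨F.range, IsFreeGroup.ofMulEquiv (MonoidHom.ofInjective hF),
    ⟨F (.of true), _, rfl⟩, ⟨F (.of false), _, rfl⟩, fun hcomm => ?_⟩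
  have hF_comm : F (.of true * .of false) = F (.of false * .of true) := by
    rw [map_mul, map_mul]
    exact congrArg Subtype.val hcomm
  exact absurd (hF hF_comm) (by decide)

theorem HasNonabelianFreeSubgroup.map {N : Type u} [Group N] {M : Type v} [Group M] (f : N →* M)
    (hf : Function.Injective f) (hN : HasNonabelianFreeSubgroup N) :
    HasNonabelianFreeSubgroup M := by
  obtain ⟨F, hF, a, b, hab⟩ := hN
  let e := F.equivMapOfInjective f hf
  exact ⟨F.map f, IsFreeGroup.ofMulEquiv e, e a, e b, fun hcomm =>
    hab (e.injective (by rwa [map_mul, map_mul]))⟩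

theorem exists_notMem_mul_notMem {N : Type*} [Group N] {S A : Subgroup N}
    (h1 : S.relIndex A ≠ 1) (h2 : S.relIndex A ≠ 2) :
    ∃ a ∈ A, ∃ b ∈ A, a ∉ S ∧ b ∉ S ∧ b * a ∉ S := by
  obtain ⟨a, ha, haS⟩ := SetLike.not_le_iff_exists.1 fun hle => h1 (Subgroup.relIndex_eq_one.2 hle)
  rw [ne_eq, Subgroup.relIndex_eq_two_iff_exists_notMem_and] at h2
  push Not at h2
  obtain ⟨b, hb, hba, hbS⟩ := h2 a ha haS
  exact ⟨a, ha, b, hb, haS, hbS, hba⟩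

theorem hasNonabelianFreeSubgroup_of_amalgam {N : Type u} [Group N] {S : Subgroup N}
    {A : κ → Subgroup N} {hSA : ∀ i, S ≤ A i} (hinj : Function.Injective (amalgamMap S A hSA))
    {i₀ i₁ : κ} (hi : i₀ ≠ i₁) (h₀ : S.relIndex (A i₀) ≠ 1) (h₀' : S.relIndex (A i₀) ≠ 2)
    (h₁ : S.relIndex (A i₁) ≠ 1) : HasNonabelianFreeSubgroup N := by
  obtain ⟨a, ha, haS⟩ := SetLike.not_le_iff_exists.1 fun hle => h₁ (Subgroup.relIndex_eq_one.2 hle)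
  obtain ⟨b, hb, b', hb', hbS, hbS', hbb'⟩ := exists_notMem_mul_notMem h₀ h₀'
  have haa : IsAlternating S A i₁ i₁ a := .of_mem ha haS
  have hz : ∀ n : ℤ, n ≠ 0 → IsAlternating S A i₀ i₀ ((b * a * b') ^ n) := fun _ =>
    (IsAlternating.of_mem hb hbS).zpow hi haa (.of_mem hb' hbS') (.of_mem (mul_mem hb' hb) hbb')
  have hs : Pairwise fun p q : Bool =>
      IsAlternating S A i₁ i₁ ((cond p a 1)⁻¹ * cond q a 1) := by
    rintro (_ | _) (_ | _) hpq
    · exact absurd rfl hpq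
    · simpa using haa
    · simpa using haa.inv
    · exact absurd rfl hpq
  exact hasNonabelianFreeSubgroup_of_injective _ (injective_freeGroupLift_conj hinj hi hz hs)

end FreeSubgroup

section Exhaustion

variable {N : Type*} [Group N] {S A : Subgroup N}

theorem exists_finite_le_sup_closure (hSA : S.relIndex A ≠ 0) :
    ∃ s : Set N, s.Finite ∧ A ≤ S ⊔ Subgroup.closure s := by
  have hfin : Finite (A ⧸ S.subgroupOf A) := Subgroup.index_ne_zero_iff_finite.1 hSA
  refine ⟨_, Set.finite_range fun q : A ⧸ S.subgroupOf A => (q.out : N), fun a ha => ?_⟩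
  obtain ⟨t, ht⟩ := QuotientGroup.mk_out_eq_mul (S.subgroupOf A) ⟨a, ha⟩
  have hta : a = (QuotientGroup.mk (s := S.subgroupOf A) ⟨a, ha⟩).out * ((t : A) : N)⁻¹ := by
    rw [ht, Subgroup.coe_mul, mul_inv_cancel_right]
  rw [hta]
  exact mul_mem (le_sup_right (a := S) (Subgroup.subset_closure ⟨_, rfl⟩))
    (le_sup_left (a := S) (inv_mem (Subgroup.mem_subgroupOf.1 t.2)))

theorem exists_le_of_le_sup_closure {T : ℝ → Subgroup N} (hT : Monotone T)
    (hN : ∀ n, ∃ c, n ∈ T c) {s : Set N} (hs : s.Finite) (hA : A ≤ S ⊔ Subgroup.closure s) {c₀ : ℝ}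
    (hS : S ≤ T c₀) : ∃ c, c₀ ≤ c ∧ A ≤ T c := by
  choose b hb using hN
  obtain ⟨B, hB⟩ := (hs.image b).bddAbove
  have hsT : s ⊆ T (max c₀ B) := fun n hn =>
    hT ((hB ⟨n, hn, rfl⟩).trans (le_max_right c₀ B)) (hb n)
  exact ⟨max c₀ B, le_max_left c₀ B, hA.trans <|
    sup_le (hS.trans (hT (le_max_left c₀ B))) ((Subgroup.closure_le _).2 hsT)⟩

end Exhaustion

section HalfLine

variable {G : Type*} [Group G] {Y : Type*} {y : Y → G} {X : Type*} {η : X → G}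

theorem exists_mem_heightSubgroup_halfLine (hy : Subgroup.closure (Set.range y) = ⊤)
    (χ : Character G) (b : Bool) (n : characterKer χ) :
    ∃ c, n ∈ heightSubgroup y χ (halfLine c b) := by
  obtain ⟨M, hM⟩ := exists_heightConnected_Icc hy χ 1 n
  exact ⟨M, mem_heightSubgroup.2 (hM.mono (Icc_subset_halfLine M b))⟩

theorem monotone_heightSubgroup_halfLine (y : Y → G) (χ : Character G) (b : Bool) :
    Monotone fun c => heightSubgroup y χ (halfLine c b) :=
  (heightSubgroup_mono y χ).comp (monotone_halfLine b)

theorem exists_heightConnected_Ici_not_Iic [Finite Y] (hy : Subgroup.closure (Set.range y) = ⊤)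
    (hη : Subgroup.closure (Set.range η) = ⊤) {χ : Character G} (hχ : χ ≠ 0)
    (hconn : ¬ (halfCayleyGraph η (-χ)).Connected) {c c' : ℝ} (hc : 0 ≤ c) (hc' : 0 ≤ c') :
    ∃ n, χ (.ofMul n) = 0 ∧ HeightConnected y χ (Set.Ici (-c)) 1 n ∧
      ¬ HeightConnected y χ (Set.Iic c') 1 n := by
  by_contra! hIci
  obtain ⟨n, hn, hnc⟩ := exists_not_heightConnected_Ici hη (neg_ne_zero.2 hχ) hconn y (-c')
  rw [heightConnected_neg, Set.neg_Ici, neg_neg] at hnc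
  exact hnc (heightConnected_Iic_of_Ici hy hχ hc hc' hIci (neg_eq_zero.1 hn))

theorem not_heightSubgroup_halfLine_le [Finite Y] (hy : Subgroup.closure (Set.range y) = ⊤)
    (hη : Subgroup.closure (Set.range η) = ⊤) {χ : Character G} (hχ : χ ≠ 0)
    (hpos : ¬ (halfCayleyGraph η χ).Connected) (hneg : ¬ (halfCayleyGraph η (-χ)).Connected)
    {c c' : ℝ} (hc : 0 ≤ c) (hc' : 0 ≤ c') (b : Bool) :
    ¬ heightSubgroup y χ (halfLine c b) ≤ heightSubgroup y χ (halfLine c' !b) := by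
  intro hle
  cases b
  · obtain ⟨n, hn, hup, hdown⟩ := exists_heightConnected_Ici_not_Iic hy hη (neg_ne_zero.2 hχ)
      ((neg_neg χ).symm ▸ hpos) hc hc'
    rw [heightConnected_neg, Set.neg_Ici, neg_neg] at hup
    rw [heightConnected_neg, Set.neg_Iic] at hdown
    exact hdown (hle (x := ⟨n, neg_eq_zero.1 hn⟩) hup)
  · obtain ⟨n, hn, hup, hdown⟩ := exists_heightConnected_Ici_not_Iic hy hη hχ hneg hc hc'
    exact hdown (hle (x := ⟨n, hn⟩) hup)

end HalfLine

section KernelSplitting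

variable {G : Type*} [Group G]

theorem exists_bijective_halfAmalgamMap [Group.IsFinitelyPresented G] (χ : Character G) :
    ∃ (n : ℕ) (y : Fin n → G) (c : ℝ), Subgroup.closure (Set.range y) = ⊤ ∧ 0 ≤ c ∧
      Function.Bijective (halfAmalgamMap y χ c) := by
  obtain ⟨n, f, hf, R, hRfin, hR⟩ := Group.IsFinitelyPresented.out (G := G)
  choose M hM using
    exists_heightConnected_Icc (FreeGroup.closure_range_of (Fin n)) (χ.comp f.toAdditive) 1
  obtain ⟨B, hB⟩ := (hRfin.image M).bddAbove
  obtain ⟨B', hB'⟩ := (Set.finite_range fun i => |χ (.ofMul (f (.of i)))|).bddAbove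
  have hc0 : 0 ≤ max 0 (max B B') := le_max_left _ _
  have hBc : B ≤ max 0 (max B B') := (le_max_left _ _).trans (le_max_right _ _)
  have hB'c : B' ≤ max 0 (max B B') := (le_max_right _ _).trans (le_max_right _ _)
  refine ⟨n, f ∘ FreeGroup.of, max 0 (max B B'),
    closure_range_comp hf (FreeGroup.closure_range_of _), hc0,
    bijective_halfAmalgamMap hf hR χ hc0 (fun i => (hB' ⟨i, rfl⟩).trans hB'c) fun r hr => ?_⟩
  have hMr := (hB ⟨r, hr, rfl⟩).trans hBc
  exact (hM r).mono (Set.Icc_subset_Icc (neg_le_neg hMr) hMr)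

theorem exists_amalgam_of_not_connected [Group.IsFinitelyPresented G] {X : Type*} {η : X → G}
    (hη : Subgroup.closure (Set.range η) = ⊤) {χ : Character G} (hχ : χ ≠ 0)
    (hpos : ¬ (halfCayleyGraph η χ).Connected) (hneg : ¬ (halfCayleyGraph η (-χ)).Connected) :
    ∃ (S : Subgroup (characterKer χ)) (A : Bool → Subgroup (characterKer χ)) (hSA : ∀ b, S ≤ A b),
      Function.Bijective (amalgamMap S A hSA) ∧ ∀ b, S.relIndex (A b) = 0 ∧ ¬ (A b).FG := by
  obtain ⟨n, y, c, hy, hc, hbij⟩ := exists_bijective_halfAmalgamMap χ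
  have hnot_le : ∀ b c', 0 ≤ c' →
      ¬ heightSubgroup y χ (halfLine c b) ≤ heightSubgroup y χ (halfLine c' !b) := fun b _ hc' =>
    not_heightSubgroup_halfLine_le hy hη hχ hpos hneg hc hc' b
  have hnot_sup : ∀ b (s : Set (characterKer χ)), s.Finite →
      ¬ heightSubgroup y χ (halfLine c b) ≤
        heightSubgroup y χ (Set.Icc (-c) c) ⊔ Subgroup.closure s := fun b s hs hle => by
    obtain ⟨c', hcc', hle'⟩ := exists_le_of_le_sup_closure
      (monotone_heightSubgroup_halfLine y χ !b) (exists_mem_heightSubgroup_halfLine hy χ !b) hs hle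
      (heightSubgroup_Icc_le_halfLine y χ c !b)
    exact hnot_le b c' (hc.trans hcc') hle'
  refine ⟨_, _, _, hbij, fun b => ⟨?_, ?_⟩⟩
  · by_contra hindex
    obtain ⟨s, hs, hle⟩ := exists_finite_le_sup_closure hindex
    exact hnot_sup b s hs hle
  · rintro ⟨s, hs⟩
    exact hnot_sup b s s.finite_toSet (hs.ge.trans le_sup_right)

end KernelSplitting

theorem exists_addMonoidHom_apply_ne_zero {B : Type*} [AddCommGroup B] {x : B}
    (hx : ¬ IsOfFinAddOrder x) : ∃ φ : B →+ ℝ, φ x ≠ 0 := by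
  have hinj : Function.Injective (zmultiplesHom B x) := injective_zsmul_iff_not_isOfFinAddOrder.2 hx
  obtain ⟨φ, hφ⟩ := (Module.Baer.of_divisible ℝ).extension_property_addMonoidHom
    (zmultiplesHom B x) hinj (Int.castAddHom ℝ)
  have hφx : φ x = 1 := by simpa using DFunLike.congr_fun hφ 1
  exact ⟨φ, hφx ▸ one_ne_zero⟩

theorem exists_character_ne_zero (G : Type*) [Group G] [Group.FG G] [Infinite (Abelianization G)] :
    ∃ χ : Character G, χ ≠ 0 := by
  have hfg : Group.FG (Abelianization G) := QuotientGroup.fg _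
  obtain ⟨x, hx⟩ : ∃ x : Additive (Abelianization G), ¬ IsOfFinAddOrder x := by
    by_contra! htorsion
    have hfin := AddCommGroup.finite_of_fg_isAddTorsion (Additive (Abelianization G)) htorsion
    exact not_finite (Additive (Abelianization G))
  obtain ⟨φ, hφ⟩ := exists_addMonoidHom_apply_ne_zero hx
  obtain ⟨g, hg⟩ := QuotientGroup.mk_surjective x.toMul
  refine ⟨φ.comp (MonoidHom.toAdditive Abelianization.of), fun h0 => hφ ?_⟩
  have hgx : Additive.ofMul (Abelianization.of g) = x := congrArg Additive.ofMul hg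
  rw [← hgx]
  exact DFunLike.congr_fun h0 (.ofMul g)

theorem isFreeProductWithAmalgamation_of_bijective {N : Type u} [Group N] {S : Subgroup N}
    {A : Bool → Subgroup N} {hSA : ∀ b, S ≤ A b} (hbij : Function.Bijective (amalgamMap S A hSA)) :
    IsFreeProductWithAmalgamation S (A false) (A true) := by
  obtain ⟨B, C, rfl⟩ : ∃ B C, A = fun b => cond b C B :=
    ⟨A false, A true, funext (Bool.rec rfl rfl)⟩
  exact ⟨hSA, hbij⟩

theorem IsFreeProductWithAmalgamation.hasNonabelianFreeSubgroup {N : Type u} [Group N]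
    {S0 Sm Sp : Subgroup N} (h : IsFreeProductWithAmalgamation S0 Sm Sp)
    (hm : S0.relIndex Sm ≠ 1) (hm' : S0.relIndex Sm ≠ 2) (hp : S0.relIndex Sp ≠ 1) :
    HasNonabelianFreeSubgroup N :=
  have ⟨_, hbij⟩ := h
  hasNonabelianFreeSubgroup_of_amalgam hbij.1 Bool.false_ne_true hm hm' hp

theorem exists_isFreeProductWithAmalgamation {G : Type u} [Group G] [Group.IsFinitelyPresented G]
    {X : Type v} {η : X → G} (hη : Subgroup.closure (Set.range η) = ⊤) {χ : Character G}
    (hχ : χ ≠ 0) (hpos : spherePoint χ hχ ∉ sigmaOne η) (hneg : -spherePoint χ hχ ∉ sigmaOne η) :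
    ∃ S0 Sm Sp : Subgroup (characterKer χ), IsFreeProductWithAmalgamation S0 Sm Sp ∧
      S0.relIndex Sm = 0 ∧ S0.relIndex Sp = 0 ∧ ¬ Sm.FG ∧ ¬ Sp.FG := by
  rw [spherePoint_mem_sigmaOne] at hpos
  rw [neg_rayOfNeZero, spherePoint_mem_sigmaOne] at hneg
  obtain ⟨S, A, hSA, hbij, hA⟩ := exists_amalgam_of_not_connected hη hχ hpos hneg
  exact ⟨S, A false, A true, isFreeProductWithAmalgamation_of_bijective hbij,
    (hA false).1, (hA true).1, (hA false).2, (hA true).2⟩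

end SigmaInvariant

theorem theoremA5p1_general {G : Type u} [Group G] [Group.IsFinitelyPresented G]
    {X : Type v} (η : X → G) (hη : Subgroup.closure (Set.range η) = ⊤) :
    (∀ (χ : SigmaInvariant.Character G) (hχ : χ ≠ 0),
      SigmaInvariant.spherePoint χ hχ ∉ SigmaInvariant.sigmaOne η →
      -SigmaInvariant.spherePoint χ hχ ∉ SigmaInvariant.sigmaOne η →
      (∃ S0 Sm Sp : Subgroup (SigmaInvariant.characterKer χ),
        SigmaInvariant.IsFreeProductWithAmalgamation S0 Sm Sp ∧
        (S0.subgroupOf Sm).index = 0 ∧ (S0.subgroupOf Sp).index = 0 ∧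
        ¬ Sm.FG ∧ ¬ Sp.FG) ∧
      SigmaInvariant.HasNonabelianFreeSubgroup (SigmaInvariant.characterKer χ)) ∧
    (¬ SigmaInvariant.HasNonabelianFreeSubgroup G →
      SigmaInvariant.sigmaOne η ∪ (fun p => -p) '' SigmaInvariant.sigmaOne η = Set.univ ∧
      (Infinite (Abelianization G) → (SigmaInvariant.sigmaOne η).Nonempty)) := by
  open SigmaInvariant in
  have hsplit := fun (χ : Character G) (hχ : χ ≠ 0) =>
    exists_isFreeProductWithAmalgamation hη hχ
  have hfree : ∀ (χ : Character G) (hχ : χ ≠ 0), spherePoint χ hχ ∉ sigmaOne η →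
      -spherePoint χ hχ ∉ sigmaOne η → HasNonabelianFreeSubgroup (characterKer χ) := by
    intro χ hχ hpos hneg
    obtain ⟨S0, Sm, Sp, hS, hm, hp, -⟩ := hsplit χ hχ hpos hneg
    exact hS.hasNonabelianFreeSubgroup (by simp [hm]) (by simp [hm]) (by simp [hp])
  refine ⟨fun χ hχ hpos hneg => ⟨hsplit χ hχ hpos hneg, hfree χ hχ hpos hneg⟩, fun hG => ?_⟩
  have hcover : sigmaOne η ∪ (fun p => -p) '' sigmaOne η = Set.univ := by
    refine Set.eq_univ_of_forall (Module.Ray.ind ℝ fun χ hχ => ?_)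
    by_contra! hχη
    rw [Set.mem_union, not_or] at hχη
    exact hG <| (hfree χ hχ hχη.1 fun hneg => hχη.2 ⟨_, hneg, neg_neg (spherePoint χ hχ)⟩).map
      (characterKer χ).subtype (Subgroup.subtype_injective _)
  refine ⟨hcover, fun _ => ?_⟩
  obtain ⟨n, f, hf, -⟩ := Group.IsFinitelyPresented.out (G := G)
  have hfg : Group.FG G := Group.fg_of_surjective hf
  obtain ⟨χ, hχ⟩ := exists_character_ne_zero G
  rcases hcover.ge (Set.mem_univ (spherePoint χ hχ)) with h | ⟨p, hp, -⟩
  exacts [⟨_, h⟩, ⟨p, hp⟩]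

theorem theoremA5p1 {G : Type u} [Group G] [Group.IsFinitelyPresented G]
    {X : Type v} (η : X → G) (hη : SigmaInvariant.IsFiniteGeneratingSystem η) :
    (∀ (χ : SigmaInvariant.Character G) (hχ : χ ≠ 0),
      SigmaInvariant.spherePoint χ hχ ∉ SigmaInvariant.sigmaOne η →
      -SigmaInvariant.spherePoint χ hχ ∉ SigmaInvariant.sigmaOne η →
      (∃ S0 Sm Sp : Subgroup (SigmaInvariant.characterKer χ),
        SigmaInvariant.IsFreeProductWithAmalgamation S0 Sm Sp ∧
        (S0.subgroupOf Sm).index = 0 ∧ (S0.subgroupOf Sp).index = 0 ∧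
        ¬ Sm.FG ∧ ¬ Sp.FG) ∧
      SigmaInvariant.HasNonabelianFreeSubgroup (SigmaInvariant.characterKer χ)) ∧
    (¬ SigmaInvariant.HasNonabelianFreeSubgroup G →
      SigmaInvariant.sigmaOne η ∪ (fun p => -p) '' SigmaInvariant.sigmaOne η = Set.univ ∧
      (Infinite (Abelianization G) → (SigmaInvariant.sigmaOne η).Nonempty)) :=
  theoremA5p1_general η hη.generates
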